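/- Let $n\ge 1$ and let $G$ be a strongly connected weighted directed graph on $V=\{1,\dots,n\}$ with nonnegative adjacency matrix $A\in\mathbb{R}^{n\times n}$, where $a_{ij}$ is the weight of the arc from $j$ to $i$ (the arc is present exactly when $a_{ij}>0$). Let $w_i=\sum_j a_{ji}$, and let $L=\operatorname{diag}(w)-A$ be the graph Laplacian. Let $d\in\mathbb{R}^n$ be any vector with all $d_i>0$ and $D=\operatorname{diag}(d)$. An absorption inverse of $L$ with respect to $d$ is a matrix $X\in\mathbb{R}^{n\times n}$ with $XLy=y$ for every $y\in\mathbb{R}^n$ such that $Dy\in\operatorname{range}L$, and $XDx=0$ for every $x\in\ker L$. Such a matrix exists and is unique; denote it by $L^d$. There is also a unique entrywise positive vector $u$ that spans $\ker L$ and satisfies $\sum_i u_i=1$; put $\bar d=\sum_i d_iu_i$. Let $\tilde G$ be the absorption-scaled graph, i.e. the weighted directed graph on $V$ with adjacency matrix $\tilde A=AD^{-1}$. A converging tree is a weakly connected directed graph in which one vertex, the root, has outdegree $0$ and every other vertex has outdegree $1$; an in-forest of $\tilde G$ is a spanning subgraph all of whose weakly connected components are converging trees. The weight $\omega$ of a subgraph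 is the product of the weights $\tilde a_{ij}$ of its arcs, and the weight of a set of subgraphs is the sum of their weights. Let $\tilde{\mathcal F}_k$ be the set of in-forests of $\tilde G$ with exactly $k$ arcs, let $\tilde{\mathcal F}_k^{i\to j}\subseteq\tilde{\mathcal F}_k$ be the set of those in which $i$ belongs to a tree with root $j$, and put $\tilde\sigma_k=\omega(\tilde{\mathcal F}_k)$, $[\tilde Q_k]_{ij}=\omega(\tilde{\mathcal F}_k^{j\to i})$ and $\tilde J_k=\tilde Q_k/\tilde\sigma_k$. (For $n=1$ the set $\tilde{\mathcal F}_{-1}$ is empty, $\tilde\sigma_{-1}=0$, $\tilde Q_{-1}=0$, and $\tilde J_{-1}$ is read as $0$.) Then $\tilde\sigma_{n-1}>0$, $\tilde\sigma_{n-2}>0$ if $n\ge2$, and $$L^d=\frac{\tilde\sigma_{n-2}}{\tilde\sigma_{n-1}}\,D^{-1}\bigl(\tilde J_{n-2}-\tilde J_{n-1}\bigr),$$ that is, for all $i,j\in V$, $$L^d_{ij}=\frac{\omega\bigl(\tilde{\mathcal F}_{n-2}^{\,j\to i}\bigr)}{d_i\,\tilde\sigma_{n-1}}-\frac{\tilde\sigma_{n-2}\,u_i}{\tilde\sigma_{n-1}\,\bar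 d}.$$ -/

import Mathlib

namespace AbsorptionGraph

variable {V : Type*} [Fintype V] [DecidableEq V]

/-! A weighted directed graph on the vertex set `V` is given by its adjacency matrix `A` with
nonnegative entries: `A i j` is the weight of the arc from `j` to `i`, and there is such an arc
exactly when `0 < A i j`. -/

/-- From every vertex there is a directed path to every other vertex. -/
def StronglyConnected (A : Matrix V V ℝ) : Prop :=
  ∀ i j : V, Relation.ReflTransGen (fun x y => 0 < A y x) i j

/-- The graph Laplacian `L = W - A`, with `W` the diagonal matrix of outdegrees `∑ j, A j i`. -/
def laplacian (A : Matrix V V ℝ) : Matrix V V ℝ :=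
  Matrix.diagonal (fun i => ∑ j, A j i) - A

/-- The set of `x` such that `D x` lies in the range of `L`, where `D = diag d`. -/
def N10 (L : Matrix V V ℝ) (d : V → ℝ) : Set (V → ℝ) :=
  {x | ∃ y, L.mulVec y = (Matrix.diagonal d).mulVec x}

/-- The set of all `D x` with `x` in the kernel of `L`, where `D = diag d`. -/
def R10 (L : Matrix V V ℝ) (d : V → ℝ) : Set (V → ℝ) :=
  {y | ∃ x, L.mulVec x = 0 ∧ y = (Matrix.diagonal d).mulVec x}

/-- `X` is an absorption inverse of `L` with respect to `d`. -/
def IsAbsorptionInverse (L : Matrix V V ℝ) (d : V → ℝ) (X : Matrix V V ℝ) : Prop :=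
  (∀ y ∈ N10 L d, X.mulVec (L.mulVec y) = y) ∧ (∀ y ∈ R10 L d, X.mulVec y = 0)

/-- `u` is entrywise positive, spans the kernel of `L`, and has entries summing to one. -/
def IsPositiveKernelBasis (L : Matrix V V ℝ) (u : V → ℝ) : Prop :=
  (∀ i, 0 < u i) ∧ LinearMap.ker (Matrix.toLin' L) = Submodule.span ℝ {u} ∧ ∑ i, u i = 1

/-- Adjacency matrix `A D⁻¹` of the absorption-scaled graph. -/
noncomputable def absorptionScaled (A : Matrix V V ℝ) (d : V → ℝ) : Matrix V V ℝ :=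
  A * (Matrix.diagonal d)⁻¹

/-! A spanning subgraph is given by its set `E` of arcs, the pair `(x, y)` being the arc
from `x` to `y`. -/

/-- The number of arcs of `E` that leave `v`. -/
def outDeg (E : Finset (V × V)) (v : V) : ℕ :=
  (E.filter (fun e => e.1 = v)).card

/-- `x` and `y` lie in the same weakly connected component of `(V, E)`. -/
def SameComponent (E : Finset (V × V)) : V → V → Prop :=
  Relation.EqvGen (fun x y => (x, y) ∈ E)

/-- The weakly connected component of `v` in `(V, E)` is a converging tree with root `r`:
`r` belongs to it and has outdegree zero, and all its other vertices have outdegree one. -/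
def ConvergesTo (E : Finset (V × V)) (v r : V) : Prop :=
  SameComponent E v r ∧ outDeg E r = 0 ∧ ∀ x, SameComponent E v x → x ≠ r → outDeg E x = 1

/-- `E` is the arc set of an in-forest of the graph with adjacency matrix `A`: a spanning subgraph
all of whose weakly connected components are converging trees. -/
def IsInForest (A : Matrix V V ℝ) (E : Finset (V × V)) : Prop :=
  (∀ e ∈ E, 0 < A e.2 e.1) ∧ ∀ v, ∃ r, ConvergesTo E v r

/-- The weight of a subgraph: the product of the weights of its arcs. -/
def arcWeight (A : Matrix V V ℝ) (E : Finset (V × V)) : ℝ :=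
  ∏ e ∈ E, A e.2 e.1

/-- The weight of a set of subgraphs: the sum of their weights. -/
def setWeight (A : Matrix V V ℝ) (S : Finset (Finset (V × V))) : ℝ :=
  ∑ E ∈ S, arcWeight A E

open Classical in
/-- The set of all in-forests with `k` arcs (empty for negative `k`). -/
noncomputable def inForests (A : Matrix V V ℝ) (k : ℤ) : Finset (Finset (V × V)) :=
  Finset.univ.filter (fun E => IsInForest A E ∧ (E.card : ℤ) = k)

open Classical in
/-- The in-forests with `k` arcs in which `i` belongs to a tree converging to the root `j`. -/
noncomputable def inForestsTo (A : Matrix V V ℝ) (k : ℤ) (i j : V) : Finset (Finset (V × V)) :=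
  (inForests A k).filter (fun E => ConvergesTo E i j)

/-- The weight of all in-forests with `k` arcs. -/
noncomputable def sigma (A : Matrix V V ℝ) (k : ℤ) : ℝ :=
  setWeight A (inForests A k)

/-- The matrix of in-forests with `k` arcs. -/
noncomputable def Q (A : Matrix V V ℝ) (k : ℤ) : Matrix V V ℝ :=
  Matrix.of fun i j => setWeight A (inForestsTo A k j i)

/-- The normalized matrix of in-forests with `k` arcs. -/
noncomputable def J (A : Matrix V V ℝ) (k : ℤ) : Matrix V V ℝ :=
  (sigma A k)⁻¹ • Q A k

end AbsorptionGraph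

/-! Write `B = L D⁻¹`; this is the Laplacian of the absorption-scaled graph. The core is the
recursion `Q_k B = σ_{k+1} 1 - Q_{k+1}` (`Q_mul_laplacian`), proved by exchanging one arc. Entry
`(i, j)` of `Q_k B` sums over forests with `k` arcs together with a choice of arc out of `j`. If `j`
is not a root, the terms cancel in pairs when the old and the new arc are swapped. If `j` is a root,
adding the arc gives each forest with `k + 1` arcs in which `j` is not a root exactly once.

Consequently every `Q_k` is a polynomial in `B` and commutes with it. No forest has `n` arcs, so the
recursion gives `Q_{n-1} B = 0` and `(Q_{n-2} / σ_{n-1}) B = 1 - J_{n-1}`. Thus `P = J_{n-1}` is the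
eigenprojection of `B` at `0`, and subtracting from `Q_{n-2} / σ_{n-1}` its component `(σ_{n-2} /
σ_{n-1}) P` leaves the group inverse `N` of `B`. The absorption inverse is `D⁻¹ N`
(`isAbsorptionInverse_iff`).

Strong connectivity enters through the maximum principle: the left kernel of a Laplacian consists of
constants. Hence `P` has constant rows, which are read off from `D u`, and comparing traces gives
the positivity of the `σ_k` (`sigma_pos`). -/

namespace AbsorptionGraph

open Relation Finset

variable {V : Type*}

/-! ### In-forests described by directed paths to sinks -/

/-- No arc of `E` leaves `r`. -/
def IsSink (E : Finset (V × V)) (r : V) : Prop := ∀ y, (r, y) ∉ E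

/-- At most one arc of `E` leaves each vertex. -/
def IsFunctional (E : Finset (V × V)) : Prop :=
  ∀ ⦃x y z⦄, (x, y) ∈ E → (x, z) ∈ E → y = z

/-- There is a directed path in `E` from `v` to `r`. -/
def Reaches (E : Finset (V × V)) : V → V → Prop := ReflTransGen fun x y => (x, y) ∈ E

/-- There is a directed path in `E` from `v` to the sink `r`. -/
def Drains (E : Finset (V × V)) (v r : V) : Prop := Reaches E v r ∧ IsSink E r

/-- `E` has at most one arc out of each vertex, and every vertex drains into a sink. -/
def IsDrainingForest (E : Finset (V × V)) : Prop :=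
  IsFunctional E ∧ ∀ v, ∃ r, Drains E v r

theorem Reaches.mono {E F : Finset (V × V)} (h : E ⊆ F) {v r : V} (hv : Reaches E v r) :
    Reaches F v r :=
  ReflTransGen.mono (fun _ _ hxy => h hxy) v r hv

theorem Reaches.sameComponent {E : Finset (V × V)} {v r : V} (h : Reaches E v r) :
    SameComponent E v r := by
  induction h with
  | refl => exact .refl _
  | tail _ h ih => exact .trans _ _ _ ih (.rel _ _ h)

theorem IsSink.eq_of_reaches {E : Finset (V × V)} {r v : V} (hr : IsSink E r)
    (h : Reaches E r v) : r = v := by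
  rcases ReflTransGen.cases_head h with h | ⟨c, hc, -⟩
  · exact h
  · exact absurd hc (hr c)

/-- In a functional graph, paths to a sink survive weak connectivity. -/
theorem reaches_of_sameComponent {E : Finset (V × V)} (hE : IsFunctional E) {r x y : V}
    (hr : IsSink E r) (h : SameComponent E x y) : Reaches E x r ↔ Reaches E y r := by
  induction h with
  | rel x y hxy =>
    refine ⟨fun h => ?_, fun h => ReflTransGen.head hxy h⟩
    rcases ReflTransGen.cases_head h with h | ⟨c, hc, h⟩
    · exact absurd hxy (h ▸ hr y)
    · rwa [hE hxy hc]
  | refl x => rfl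
  | symm x y _ ih => exact ih.symm
  | trans x y z _ _ h₁ h₂ => exact h₁.trans h₂

theorem Drains.unique {E : Finset (V × V)} (hE : IsFunctional E) {v r s : V}
    (hr : Drains E v r) (hs : Drains E v s) : r = s := by
  have h : SameComponent E v s := hs.1.sameComponent
  exact (hs.2.eq_of_reaches ((reaches_of_sameComponent hE hr.2 h).1 hr.1)).symm

open Classical in
/-- The indicator of `v` draining into `r`. -/
noncomputable def drainInd (E : Finset (V × V)) (v r : V) : ℝ := if Drains E v r then 1 else 0

theorem drainInd_of_reaches {E : Finset (V × V)} (hE : IsFunctional E) {j l : V}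
    (hl : Reaches E l j) (i : V) : drainInd E l i = drainInd E j i := by
  have : Drains E l i ↔ Drains E j i := and_congr_left fun hi =>
    reaches_of_sameComponent hE hi hl.sameComponent
  classical simp only [drainInd, this]

theorem sum_drainInd [Fintype V] {E : Finset (V × V)} (hE : IsDrainingForest E) (v : V) :
    ∑ r, drainInd E v r = 1 := by
  obtain ⟨r, hr⟩ := hE.2 v
  rw [sum_eq_single r]
  · simp [drainInd, hr]
  · intro s _ hs
    exact if_neg fun h => hs (h.unique hE.1 hr)
  · simp

theorem arcWeight_nonneg {A : Matrix V V ℝ} (hA : ∀ i j, 0 ≤ A i j) (E : Finset (V × V)) :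
    0 ≤ arcWeight A E := prod_nonneg fun _ _ => hA _ _

variable [DecidableEq V]

theorem outDeg_eq_zero_iff (E : Finset (V × V)) (r : V) : outDeg E r = 0 ↔ IsSink E r := by
  simp only [outDeg, IsSink, card_eq_zero, filter_eq_empty_iff, Prod.forall]
  exact ⟨fun h y hy => h r y hy rfl, fun h a b hab e => h b (e ▸ hab)⟩

theorem isFunctional_iff (E : Finset (V × V)) : IsFunctional E ↔ ∀ v, outDeg E v ≤ 1 := by
  simp only [outDeg, card_le_one, mem_filter, IsFunctional]
  constructor
  · rintro h v ⟨a, b⟩ ⟨ha, rfl⟩ ⟨c, d⟩ ⟨hc, rfl⟩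
    rw [h ha hc]
  · intro h x y z hy hz
    simpa using h x _ ⟨hy, rfl⟩ _ ⟨hz, rfl⟩

/-- Once outdegrees are at most one, weak connectivity to a sink already yields a directed path.
Conversely, a vertex of the component with outdegree zero would have to be the sink that it reaches.
-/
theorem convergesTo_iff_drains {E : Finset (V × V)} (hE : IsFunctional E) (v r : V) :
    ConvergesTo E v r ↔ Drains E v r := by
  constructor
  · rintro ⟨h, h0, -⟩
    rw [outDeg_eq_zero_iff] at h0
    exact ⟨(reaches_of_sameComponent hE h0 h).2 .refl, h0⟩
  · rintro ⟨h, h0⟩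
    refine ⟨Reaches.sameComponent h, (outDeg_eq_zero_iff E r).2 h0, fun x hx hxr => ?_⟩
    have h1 := (isFunctional_iff E).1 hE x
    have h2 : outDeg E x ≠ 0 := fun h2 =>
      hxr (((outDeg_eq_zero_iff E x).1 h2).eq_of_reaches
        ((reaches_of_sameComponent hE h0 hx).1 h))
    omega

/-- This separates the condition on the weights from the shape of the arc set, so that the
combinatorics can ignore `A`. -/
theorem isInForest_iff (A : Matrix V V ℝ) (E : Finset (V × V)) :
    IsInForest A E ↔ (∀ e ∈ E, 0 < A e.2 e.1) ∧ IsDrainingForest E := by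
  refine and_congr_right fun _ => ⟨fun h => ?_, fun h v => ?_⟩
  · have hE : IsFunctional E := (isFunctional_iff E).2 fun v => by
      obtain ⟨r, -, h0, h1⟩ := h v
      by_cases hv : v = r
      · rw [hv, h0]; exact zero_le_one
      · exact (h1 v (.refl v) hv).le
    exact ⟨hE, fun v => (h v).imp fun r => (convergesTo_iff_drains hE v r).1⟩
  · exact (h.2 v).imp fun r => (convergesTo_iff_drains h.1 v r).2

/-! ### Adding and removing the arc out of a vertex -/

theorem reaches_insert_iff {G : Finset (V × V)} {j l v r : V} (hv : ¬ Reaches G v j) :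
    Reaches (insert (j, l) G) v r ↔ Reaches G v r := by
  refine ⟨fun h => ?_, fun h => h.mono (subset_insert _ _)⟩
  induction h with
  | refl => exact .refl
  | tail _ hbc ih =>
    rcases mem_insert.1 hbc with h | h
    · simp only [Prod.mk.injEq] at h
      exact absurd (h.1 ▸ ih) hv
    · exact ih.tail h

theorem IsFunctional.insert {G : Finset (V × V)} (hG : IsFunctional G) {j l : V}
    (hj : IsSink G j) : IsFunctional (insert (j, l) G) := by
  intro x y z hy hz
  simp only [mem_insert, Prod.mk.injEq] at hy hz
  rcases hy with ⟨rfl, rfl⟩ | hy <;> rcases hz with ⟨h, rfl⟩ | hz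
  · rfl
  · exact absurd hz (hj z)
  · exact absurd (h ▸ hy) (hj y)
  · exact hG hy hz

/-- Vertices that avoid `j` drain as before once the arc `(j, l)` is added. -/
theorem drains_insert_of_not_reaches {G : Finset (V × V)} {j l v r : V} (hv : ¬ Reaches G v j) :
    Drains (insert (j, l) G) v r ↔ Drains G v r := by
  simp only [Drains, reaches_insert_iff hv]
  refine and_congr_right fun h => ⟨fun hr y hy => hr y (mem_insert_of_mem hy), fun hr y hy => ?_⟩
  rcases mem_insert.1 hy with e | hy
  · simp only [Prod.mk.injEq] at e
    exact hv (e.1 ▸ h)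
  · exact hr y hy

/-- Vertices in the tree of `j` drain like `l` once the arc `(j, l)` is added. -/
theorem drains_insert_of_reaches {G : Finset (V × V)} (hG : IsFunctional G) {j l : V}
    (hj : IsSink G j) (hl : ¬ Reaches G l j) {v r : V} (hv : Reaches G v j) :
    Drains (insert (j, l) G) v r ↔ Drains G l r := by
  rw [← drains_insert_of_not_reaches hl]
  have hvj : Reaches (insert (j, l) G) v j := hv.mono (subset_insert _ _)
  have hvl : Reaches (insert (j, l) G) v l := hvj.tail (mem_insert_self _ _)
  refine and_congr_left fun hr => ?_
  exact reaches_of_sameComponent (hG.insert hj) hr hvl.sameComponent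

theorem IsDrainingForest.insert {G : Finset (V × V)} (hG : IsDrainingForest G) {j l : V}
    (hj : IsSink G j) (hl : ¬ Reaches G l j) : IsDrainingForest (insert (j, l) G) := by
  refine ⟨hG.1.insert hj, fun v => ?_⟩
  by_cases hv : Reaches G v j
  · simpa only [drains_insert_of_reaches hG.1 hj hl hv] using hG.2 l
  · simpa only [drains_insert_of_not_reaches hv] using hG.2 v

theorem IsFunctional.isSink_erase {E : Finset (V × V)} (hE : IsFunctional E) {j l : V}
    (h : (j, l) ∈ E) : IsSink (E.erase (j, l)) j := fun y hy => by
  rw [mem_erase] at hy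
  exact hy.1 (by rw [hE hy.2 h])

theorem IsDrainingForest.erase {E : Finset (V × V)} (hE : IsDrainingForest E) {j l : V}
    (h : (j, l) ∈ E) : IsDrainingForest (E.erase (j, l)) := by
  refine ⟨fun x y z hy hz => hE.1 (mem_of_mem_erase hy) (mem_of_mem_erase hz), fun v => ?_⟩
  obtain ⟨r, hvr, hr⟩ := hE.2 v
  have hr' : IsSink (E.erase (j, l)) r := fun y hy => hr y (mem_of_mem_erase hy)
  induction hvr using ReflTransGen.head_induction_on with
  | refl => exact ⟨r, .refl, hr'⟩
  | @head a c hac _ ih =>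
    -- A path that uses the deleted arc is cut off at `j`, which has become a sink.
    by_cases e : (a, c) = (j, l)
    · simp only [Prod.mk.injEq] at e
      exact ⟨j, e.1 ▸ .refl, hE.1.isSink_erase h⟩
    · obtain ⟨s, hs, hs'⟩ := ih
      exact ⟨s, ReflTransGen.head (mem_erase.2 ⟨e, hac⟩) hs, hs'⟩

/-- A draining forest has no directed cycle through `(j, l)`. -/
theorem IsDrainingForest.not_reaches_erase {E : Finset (V × V)} (hE : IsDrainingForest E)
    {j l : V} (h : (j, l) ∈ E) : ¬ Reaches (E.erase (j, l)) l j := by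
  intro hlj
  have hlj' : Reaches E l j := hlj.mono (erase_subset _ _)
  obtain ⟨r, hjr, hr⟩ := hE.2 j
  -- A path from `l` back to `j` closes a cycle, and functionality keeps every path from `j` on it.
  -- The sink below `j` would then be `j` itself, which has the outgoing arc `(j, l)`.
  have key : ∀ x, Reaches E j x → Reaches E x j := by
    intro x hx
    induction hx with
    | refl => exact .refl
    | tail _ hbc ih =>
      rcases ReflTransGen.cases_head ih with e | ⟨c, hc, hcj⟩
      · subst e
        rwa [hE.1 hbc h]
      · rwa [hE.1 hbc hc]
  exact hr l (hr.eq_of_reaches (key r hjr) ▸ h)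

theorem drainInd_of_isSink {E : Finset (V × V)} {j : V} (hj : IsSink E j) (i : V) :
    drainInd E j i = if i = j then 1 else 0 := by
  have : Drains E j i ↔ i = j :=
    ⟨fun h => (hj.eq_of_reaches h.1).symm, fun h => h ▸ ⟨.refl, h ▸ hj⟩⟩
  simp only [drainInd, this]

theorem arcWeight_insert (A : Matrix V V ℝ) {G : Finset (V × V)} {j : V} (hj : IsSink G j)
    (l : V) : arcWeight A (insert (j, l) G) = A l j * arcWeight A G :=
  prod_insert (hj l)

/-! ### Weights of forests -/

variable [Fintype V]

open Classical in
/-- The draining forests with `k` arcs. -/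
noncomputable def drainingForests (V : Type*) [Fintype V] (k : ℤ) : Finset (Finset (V × V)) :=
  univ.filter fun E => IsDrainingForest E ∧ (E.card : ℤ) = k

/-- A forest with an arc of weight zero contributes zero, so the sum may run over an index set that
does not depend on `A`. -/
theorem sum_inForests {A : Matrix V V ℝ} (hA : ∀ i j, 0 ≤ A i j) (k : ℤ)
    (f : Finset (V × V) → ℝ) :
    ∑ E ∈ inForests A k, arcWeight A E * f E =
      ∑ E ∈ drainingForests V k, arcWeight A E * f E := by
  classical
  refine sum_subset (fun E hE => ?_) fun E hE hE' => ?_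
  · simp only [inForests, drainingForests, mem_filter, isInForest_iff] at hE ⊢
    exact ⟨hE.1, hE.2.1.2, hE.2.2⟩
  · simp only [inForests, drainingForests, mem_filter, isInForest_iff, mem_univ, true_and] at hE hE'
    have : ∃ e ∈ E, A e.2 e.1 ≤ 0 := by
      by_contra! h
      exact hE' ⟨⟨h, hE.1⟩, hE.2⟩
    obtain ⟨e, he, h⟩ := this
    rw [arcWeight, prod_eq_zero he (le_antisymm h (hA _ _)), zero_mul]

theorem sigma_eq_sum {A : Matrix V V ℝ} (hA : ∀ i j, 0 ≤ A i j) (k : ℤ) :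
    sigma A k = ∑ E ∈ drainingForests V k, arcWeight A E := by
  simpa [sigma, setWeight] using sum_inForests hA k fun _ => 1

theorem Q_apply_eq_sum {A : Matrix V V ℝ} (hA : ∀ i j, 0 ≤ A i j) (k : ℤ) (i j : V) :
    Q A k i j = ∑ E ∈ drainingForests V k, arcWeight A E * drainInd E j i := by
  classical
  rw [← sum_inForests hA, Q, Matrix.of_apply, setWeight, inForestsTo, sum_filter]
  refine sum_congr rfl fun E hE => ?_
  simp only [inForests, mem_filter, isInForest_iff] at hE
  simp only [drainInd, convergesTo_iff_drains hE.2.1.2.1, mul_ite, mul_one, mul_zero]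

/-- The left side counts the roots. Every other vertex has exactly one outgoing arc, so non-roots
and arcs are equinumerous. -/
theorem sum_drainInd_self {E : Finset (V × V)} (hE : IsFunctional E) :
    ∑ r, drainInd E r r = Fintype.card V - E.card := by
  classical
  have h1 : E.card = (univ.filter fun r => ¬ IsSink E r).card := by
    refine card_bij (fun e _ => e.1) ?_ ?_ ?_
    · rintro ⟨x, y⟩ h
      exact mem_filter.2 ⟨mem_univ _, fun hx => hx y h⟩
    · rintro ⟨x, y⟩ h ⟨x', z⟩ h' (rfl : x = x')
      rw [hE h h']
    · intro x hx
      simp only [IsSink, mem_filter, mem_univ, true_and, not_forall, not_not] at hx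
      obtain ⟨y, hy⟩ := hx
      exact ⟨(x, y), hy, rfl⟩
  have h2 : ∑ r, drainInd E r r = (univ.filter fun r => IsSink E r).card := by
    rw [card_filter, Nat.cast_sum]
    refine sum_congr rfl fun r _ => ?_
    by_cases hr : IsSink E r
    · simp [drainInd_of_isSink hr, hr]
    · simp [drainInd, Drains, hr]
  rw [h1, h2, eq_sub_iff_add_eq, ← Nat.cast_add, card_filter_add_card_filter_not, card_univ]

open Classical in
/-- A forest in which `j` is not a root arises uniquely from one in which `j` is a root,
by adding an arc from `j` to a vertex outside the tree of `j`. -/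
theorem sum_not_isSink (j : V) (k : ℤ) (f : Finset (V × V) → ℝ) :
    ∑ E ∈ drainingForests V (k + 1) with ¬ IsSink E j, f E =
      ∑ G ∈ drainingForests V k with IsSink G j,
        ∑ l with ¬ Reaches G l j, f (insert (j, l) G) := by
  rw [sum_sigma']
  symm
  refine sum_bij (fun x _ => insert (j, x.2) x.1) ?_ ?_ ?_ fun _ _ => rfl
  · rintro ⟨G, l⟩ h
    simp only [drainingForests, mem_sigma, mem_filter, mem_univ, true_and] at h ⊢
    obtain ⟨⟨⟨hG, hk⟩, hj⟩, hl⟩ := h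
    refine ⟨⟨hG.insert hj hl, ?_⟩, fun h => h l (mem_insert_self _ _)⟩
    rw [card_insert_of_notMem (hj l), Nat.cast_add, hk, Nat.cast_one]
  · rintro ⟨G, l⟩ h ⟨G', l'⟩ h' (e : insert (j, l) G = insert (j, l') G')
    simp only [drainingForests, mem_sigma, mem_filter, mem_univ, true_and] at h h'
    have hl : l = l' := (h.1.1.1.1.insert h.1.2) (mem_insert_self (j, l) G)
      (e ▸ mem_insert_self (j, l') G')
    subst hl
    have hG := congrArg (fun E => E.erase (j, l)) e
    simp only [erase_insert (h.1.2 l), erase_insert (h'.1.2 l)] at hG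
    rw [hG]
  · intro E h
    simp only [drainingForests, mem_filter, mem_univ, true_and, IsSink, not_forall, not_not] at h
    obtain ⟨⟨hE, hk⟩, l, hl⟩ := h
    refine ⟨⟨E.erase (j, l), l⟩, ?_, insert_erase hl⟩
    simp only [drainingForests, mem_sigma, mem_filter, mem_univ, true_and]
    refine ⟨⟨⟨hE.erase hl, ?_⟩, hE.1.isSink_erase hl⟩, hE.not_reaches_erase hl⟩
    have := card_erase_add_one hl
    omega

open Classical in
/-- Replacing the arc out of a vertex that is not a root is an involution, so these terms cancel. -/
theorem sum_not_isSink_eq_zero (A : Matrix V V ℝ) (i j : V) (k : ℤ) :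
    ∑ E ∈ drainingForests V k with ¬ IsSink E j,
      arcWeight A E * ∑ l, A l j * (drainInd E l i - drainInd E j i) = 0 := by
  obtain ⟨k, rfl⟩ : ∃ m, k = m + 1 := ⟨k - 1, by ring⟩
  rw [sum_not_isSink]
  refine sum_eq_zero fun G hG => ?_
  simp only [drainingForests, mem_filter, mem_univ, true_and] at hG
  obtain ⟨⟨hG, -⟩, hj⟩ := hG
  -- After the arc `(j, m)` is added, the whole former tree of `j` drains like `m`. So only those
  -- `l` outside that tree contribute, and they drain as they did in `G`.
  have key : ∀ m ∈ univ.filter (fun l => ¬ Reaches G l j),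
      arcWeight A (insert (j, m) G) * ∑ l, A l j *
        (drainInd (insert (j, m) G) l i - drainInd (insert (j, m) G) j i) =
      arcWeight A G * ∑ l with ¬ Reaches G l j,
        A m j * A l j * (drainInd G l i - drainInd G m i) := by
    intro m hm
    have hm : ¬ Reaches G m j := (mem_filter.1 hm).2
    rw [arcWeight_insert A hj, sum_filter, mul_comm (A m j), mul_assoc, mul_sum]
    congr 1
    refine sum_congr rfl fun l _ => ?_
    have h1 : drainInd (insert (j, m) G) j i = drainInd G m i := by
      simp only [drainInd, drains_insert_of_reaches hG.1 hj hm (ReflTransGen.refl : Reaches G j j)]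
    by_cases hl : Reaches G l j
    · have h2 : drainInd (insert (j, m) G) l i = drainInd G m i := by
        simp only [drainInd, drains_insert_of_reaches hG.1 hj hm hl]
      simp [h1, h2, hl]
    · have h2 : drainInd (insert (j, m) G) l i = drainInd G l i := by
        simp only [drainInd, drains_insert_of_not_reaches hl]
      simp [h1, h2, hl, mul_assoc]
  rw [sum_congr rfl key, ← mul_sum]
  refine mul_eq_zero_of_right _ ?_
  set S := univ.filter fun l => ¬ Reaches G l j
  -- The summand is antisymmetric in `m` and `l`, so the double sum equals its own negative.
  have h : ∑ m ∈ S, ∑ l ∈ S, A m j * A l j * (drainInd G l i - drainInd G m i) =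
      -∑ m ∈ S, ∑ l ∈ S, A m j * A l j * (drainInd G l i - drainInd G m i) := by
    conv_lhs => rw [sum_comm]
    simp only [← sum_neg_distrib]
    exact sum_congr rfl fun _ _ => sum_congr rfl fun _ _ => by ring
  linarith

/-- On the left only forests with `j` a root survive, on the right only those with `j` not a root.
Adding an arc `(j, l)` matches them; an `l` inside the tree of `j` would close a cycle, but its term
vanishes because `l` and `j` drain alike. -/
theorem sum_drainInd_recurrence (A : Matrix V V ℝ) (i j : V) (k : ℤ) :
    ∑ E ∈ drainingForests V k,
        arcWeight A E * ∑ l, A l j * (drainInd E l i - drainInd E j i) =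
      ∑ E ∈ drainingForests V (k + 1),
        arcWeight A E * (drainInd E j i - if i = j then 1 else 0) := by
  classical
  rw [← sum_filter_add_sum_filter_not _ (fun E => IsSink E j), sum_not_isSink_eq_zero, add_zero,
    ← sum_filter_add_sum_filter_not (drainingForests V (k + 1)) (fun E => IsSink E j)]
  have h0 : ∑ E ∈ drainingForests V (k + 1) with IsSink E j,
      arcWeight A E * (drainInd E j i - if i = j then 1 else 0) = 0 :=
    sum_eq_zero fun E hE => by rw [drainInd_of_isSink (mem_filter.1 hE).2, sub_self, mul_zero]
  rw [h0, zero_add, sum_not_isSink]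
  refine sum_congr rfl fun G hG => ?_
  simp only [drainingForests, mem_filter, mem_univ, true_and] at hG
  obtain ⟨⟨hG, -⟩, hj⟩ := hG
  rw [mul_sum, sum_filter]
  refine sum_congr rfl fun l _ => ?_
  by_cases hl : Reaches G l j
  · simp [hl, drainInd_of_reaches hG.1 hl]
  · have h1 : drainInd (insert (j, l) G) j i = drainInd G l i := by
      simp only [drainInd, drains_insert_of_reaches hG.1 hj hl (ReflTransGen.refl : Reaches G j j)]
    rw [if_pos hl, h1, arcWeight_insert A hj, drainInd_of_isSink hj]
    ring

/-! ### The matrices of forests -/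

/-- This is `sum_drainInd_recurrence` read entrywise, with the sign reversed. -/
theorem Q_mul_laplacian {A : Matrix V V ℝ} (hA : ∀ i j, 0 ≤ A i j) (k : ℤ) :
    Q A k * laplacian A = sigma A (k + 1) • (1 : Matrix V V ℝ) - Q A (k + 1) := by
  ext i j
  have h := sum_drainInd_recurrence A i j k
  have h1 : (Q A k * laplacian A) i j = -∑ E ∈ drainingForests V k,
      arcWeight A E * ∑ l, A l j * (drainInd E l i - drainInd E j i) := by
    rw [laplacian, Matrix.mul_sub, Matrix.sub_apply, Matrix.mul_diagonal, Matrix.mul_apply]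
    simp only [Q_apply_eq_sum hA, mul_sub, sum_sub_distrib, sum_mul, mul_sum]
    rw [sum_comm, sum_comm (s := (univ : Finset V)) (t := drainingForests V k), neg_sub]
    congr 1 <;> exact sum_congr rfl fun _ _ => sum_congr rfl fun _ _ => by ring
  rw [h1, h, Matrix.sub_apply, Matrix.smul_apply, Matrix.one_apply, Q_apply_eq_sum hA,
    sigma_eq_sum hA, smul_eq_mul, sum_mul, ← sum_neg_distrib, ← sum_sub_distrib]
  exact sum_congr rfl fun _ _ => by ring

/-- In each forest, `j` drains into exactly one root. -/
theorem sum_Q_apply {A : Matrix V V ℝ} (hA : ∀ i j, 0 ≤ A i j) (k : ℤ) (j : V) :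
    ∑ i, Q A k i j = sigma A k := by
  simp only [Q_apply_eq_sum hA, sigma_eq_sum hA]
  rw [sum_comm]
  refine sum_congr rfl fun E hE => ?_
  simp only [drainingForests, mem_filter] at hE
  rw [← mul_sum, sum_drainInd hE.2.1, mul_one]

theorem sum_Q_diag {A : Matrix V V ℝ} (hA : ∀ i j, 0 ≤ A i j) (k : ℤ) :
    ∑ i, Q A k i i = (Fintype.card V - k) * sigma A k := by
  simp only [Q_apply_eq_sum hA, sigma_eq_sum hA]
  rw [sum_comm, mul_sum]
  refine sum_congr rfl fun E hE => ?_
  simp only [drainingForests, mem_filter] at hE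
  rw [← mul_sum, sum_drainInd_self hE.2.1.1, mul_comm, ← hE.2.2, Int.cast_natCast]

theorem Q_nonneg {A : Matrix V V ℝ} (hA : ∀ i j, 0 ≤ A i j) (k : ℤ) (i j : V) :
    0 ≤ Q A k i j :=
  sum_nonneg fun E _ => arcWeight_nonneg hA E

theorem sigma_nonneg {A : Matrix V V ℝ} (hA : ∀ i j, 0 ≤ A i j) (k : ℤ) : 0 ≤ sigma A k :=
  sum_nonneg fun E _ => arcWeight_nonneg hA E

theorem Q_eq_zero_of_sigma_eq_zero {A : Matrix V V ℝ} (hA : ∀ i j, 0 ≤ A i j) {k : ℤ}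
    (h : sigma A k = 0) : Q A k = 0 := by
  ext i j
  exact (sum_eq_zero_iff_of_nonneg fun i _ => Q_nonneg hA k i j).1
    ((sum_Q_apply hA k j).trans h) i (mem_univ i)

theorem sigma_of_neg {A : Matrix V V ℝ} {k : ℤ} (hk : k < 0) : sigma A k = 0 := by
  classical
  refine sum_eq_zero fun E hE => ?_
  simp only [inForests, mem_filter] at hE
  omega

theorem sigma_zero_pos {A : Matrix V V ℝ} (hA : ∀ i j, 0 ≤ A i j) : 0 < sigma A 0 := by
  classical
  refine sum_pos' (fun E _ => arcWeight_nonneg hA E) ⟨∅, ?_, by simp [arcWeight]⟩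
  simp only [inForests, mem_filter, isInForest_iff, mem_univ, true_and]
  refine ⟨⟨by simp, fun x y z h => by simp at h, fun v => ⟨v, .refl, fun y => by simp⟩⟩, by simp⟩

/-- With as many arcs as vertices no root is left, so the trace of `Q` vanishes; yet every forest
has a root `r` and puts its weight into the diagonal entry at `r`. -/
theorem sigma_card_eq_zero [Nonempty V] {A : Matrix V V ℝ} (hA : ∀ i j, 0 ≤ A i j) :
    sigma A (Fintype.card V) = 0 := by
  have h := sum_Q_diag hA (Fintype.card V)
  rw [Int.cast_natCast, sub_self, zero_mul] at h
  have hz := (sum_eq_zero_iff_of_nonneg fun i _ => Q_nonneg hA _ i i).1 h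
  rw [sigma_eq_sum hA]
  refine sum_eq_zero fun E hE => ?_
  have hE' := hE
  simp only [drainingForests, mem_filter] at hE
  obtain ⟨r, hr⟩ := hE.2.1.2 (Classical.arbitrary V)
  have h1 := hz r (mem_univ r)
  rw [Q_apply_eq_sum hA] at h1
  have h2 := (sum_eq_zero_iff_of_nonneg fun F _ => mul_nonneg (arcWeight_nonneg hA F)
    (by unfold drainInd; split_ifs <;> norm_num)).1 h1 E hE'
  simpa [drainInd_of_isSink hr.2] using h2

/-- By the recursion each `Q` is a polynomial in the Laplacian. -/
theorem commute_Q_laplacian {A : Matrix V V ℝ} (hA : ∀ i j, 0 ≤ A i j) (k : ℤ) :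
    Commute (Q A k) (laplacian A) := by
  -- The index is shifted by one so that the induction starts from the zero matrix at `-1`.
  have h : ∀ m : ℕ, Commute (Q A (m - 1 : ℤ)) (laplacian A) := by
    intro m
    induction m with
    | zero =>
      rw [Q_eq_zero_of_sigma_eq_zero hA (sigma_of_neg (by simp))]
      exact Commute.zero_left _
    | succ m ih =>
      have e := Q_mul_laplacian hA (m - 1 : ℤ)
      have e' : ((m + 1 : ℕ) : ℤ) - 1 = m - 1 + 1 := by push_cast; ring
      rw [e', ← sub_sub_cancel (sigma A (m - 1 + 1) • (1 : Matrix V V ℝ)) (Q A (m - 1 + 1)), ← e]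
      exact ((Commute.one_left _).smul_left _).sub_left (ih.mul_left (Commute.refl _))
  rcases lt_or_ge k 0 with hk | hk
  · rw [Q_eq_zero_of_sigma_eq_zero hA (sigma_of_neg hk)]
    exact Commute.zero_left _
  · lift k to ℕ using hk
    simpa using h (k + 1)

/-! ### Strongly connected graphs -/

theorem laplacian_mulVec_apply (A : Matrix V V ℝ) (x : V → ℝ) (i : V) :
    (laplacian A).mulVec x i = (∑ j, A j i) * x i - ∑ j, A i j * x j := by
  rw [laplacian, Matrix.sub_mulVec, Pi.sub_apply, Matrix.mulVec_diagonal]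
  rfl

theorem vecMul_laplacian_apply (A : Matrix V V ℝ) (p : V → ℝ) (j : V) :
    Matrix.vecMul p (laplacian A) j = ∑ l, A l j * (p j - p l) := by
  rw [laplacian, Matrix.vecMul_sub, Pi.sub_apply, Matrix.vecMul_diagonal, mul_sum,
    Matrix.vecMul, dotProduct, ← sum_sub_distrib]
  exact sum_congr rfl fun _ _ => by ring

/-- Maximum principle: the left kernel of the Laplacian consists of constant vectors. -/
theorem eq_of_vecMul_laplacian_eq_zero {A : Matrix V V ℝ} (hA : ∀ i j, 0 ≤ A i j)
    (hconn : StronglyConnected A) {p : V → ℝ} (hp : Matrix.vecMul p (laplacian A) = 0)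
    (i j : V) : p i = p j := by
  have : Nonempty V := ⟨i⟩
  obtain ⟨m, hm⟩ := Finite.exists_max p
  have key : ∀ x, p x = p m := by
    intro x
    induction hconn m x with
    | refl => rfl
    | @tail b c _ hbc ih =>
      have h := congrFun hp b
      rw [vecMul_laplacian_apply, Pi.zero_apply] at h
      have h0 := (sum_eq_zero_iff_of_nonneg fun l _ => mul_nonneg (hA l b)
        (sub_nonneg.2 (ih ▸ hm l))).1 h c (mem_univ c)
      rcases mul_eq_zero.1 h0 with h0 | h0
      · exact absurd h0 hbc.ne'
      · linarith
  rw [key i, key j]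

/-- A nonnegative nonzero kernel vector of the Laplacian is positive. -/
theorem pos_of_laplacian_mulVec_eq_zero {A : Matrix V V ℝ} (hA : ∀ i j, 0 ≤ A i j)
    (hconn : StronglyConnected A) {x : V → ℝ} (hx : (laplacian A).mulVec x = 0)
    (hx0 : ∀ i, 0 ≤ x i) (hne : x ≠ 0) (i : V) : 0 < x i := by
  refine lt_of_le_of_ne (hx0 i) fun h => hne (funext fun j => ?_)
  induction hconn j i using ReflTransGen.head_induction_on with
  | refl => exact h.symm
  | @head a c hac _ ih =>
    have h1 := congrFun hx c
    rw [laplacian_mulVec_apply, ih, Pi.zero_apply, mul_zero, zero_sub, neg_eq_zero] at h1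
    have h2 := (sum_eq_zero_iff_of_nonneg fun l _ => mul_nonneg (hA c l) (hx0 l)).1 h1 a (mem_univ a)
    exact (mul_eq_zero.1 h2).resolve_left hac.ne'

theorem row_eq_of_mul_laplacian_eq_zero {A : Matrix V V ℝ} (hA : ∀ i j, 0 ≤ A i j)
    (hconn : StronglyConnected A) {M : Matrix V V ℝ} (hM : M * laplacian A = 0)
    (i j l : V) : M i j = M i l :=
  eq_of_vecMul_laplacian_eq_zero hA hconn (p := M i) (by
    ext c
    exact congrFun (congrFun hM i) c) j l

/-- If `σ_{k+1} = 0`, then `Q_k` annihilates the Laplacian from the left, so its rows are constant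
and its trace equals a column sum, namely `σ_k`. But the trace is `(n - k) σ_k`, which forces `n = k
+ 1`. No spanning tree needs to be constructed. -/
theorem sigma_pos {A : Matrix V V ℝ} (hA : ∀ i j, 0 ≤ A i j)
    (hconn : StronglyConnected A) (k : ℕ) (hk : k < Fintype.card V) : 0 < sigma A k := by
  induction k with
  | zero => exact sigma_zero_pos hA
  | succ k ih =>
    have ih := ih (by omega)
    refine lt_of_le_of_ne (sigma_nonneg hA _) fun h => ?_
    rw [Nat.cast_succ] at h
    have hQ := Q_mul_laplacian hA k
    rw [← h, Q_eq_zero_of_sigma_eq_zero hA h.symm, zero_smul, sub_zero] at hQ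
    obtain ⟨j⟩ : Nonempty V := Fintype.card_pos_iff.1 (by omega)
    have h1 := sum_Q_diag hA (A := A) k
    rw [sum_congr rfl fun i _ => row_eq_of_mul_laplacian_eq_zero hA hconn hQ i i j,
      sum_Q_apply hA] at h1
    have h2 : ((Fintype.card V : ℝ) - (k : ℤ)) = 1 := (mul_eq_right₀ ih.ne').1 h1.symm
    have h3 : (Fintype.card V : ℝ) = (k + 1 : ℕ) := by push_cast at h2 ⊢; linarith
    have h4 : Fintype.card V = k + 1 := by exact_mod_cast h3
    omega

/-! ### The absorption inverse -/

theorem diagonal_inv {d : V → ℝ} (hd : ∀ i, 0 < d i) :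
    (Matrix.diagonal d)⁻¹ = Matrix.diagonal fun i => (d i)⁻¹ := by
  refine Matrix.inv_eq_right_inv ?_
  rw [Matrix.diagonal_mul_diagonal, ← Matrix.diagonal_one]
  congr 1
  ext i
  exact mul_inv_cancel₀ (hd i).ne'

theorem isUnit_det_diagonal {d : V → ℝ} (hd : ∀ i, 0 < d i) :
    IsUnit (Matrix.diagonal d).det := by
  rw [Matrix.det_diagonal, isUnit_iff_ne_zero]
  exact prod_ne_zero_iff.2 fun i _ => (hd i).ne'

theorem absorptionScaled_apply (A : Matrix V V ℝ) {d : V → ℝ} (hd : ∀ i, 0 < d i) (i j : V) :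
    absorptionScaled A d i j = A i j * (d j)⁻¹ := by
  rw [absorptionScaled, diagonal_inv hd, Matrix.mul_diagonal]

theorem absorptionScaled_nonneg {A : Matrix V V ℝ} (hA : ∀ i j, 0 ≤ A i j) {d : V → ℝ}
    (hd : ∀ i, 0 < d i) (i j : V) : 0 ≤ absorptionScaled A d i j := by
  rw [absorptionScaled_apply A hd]
  exact mul_nonneg (hA i j) (inv_nonneg.2 (hd j).le)

theorem laplacian_absorptionScaled (A : Matrix V V ℝ) {d : V → ℝ} (hd : ∀ i, 0 < d i) :
    laplacian (absorptionScaled A d) = laplacian A * (Matrix.diagonal d)⁻¹ := by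
  rw [laplacian, laplacian, Matrix.sub_mul, ← absorptionScaled.eq_def A d, diagonal_inv hd,
    Matrix.diagonal_mul_diagonal]
  simp only [absorptionScaled_apply A hd, sum_mul]

theorem stronglyConnected_absorptionScaled {A : Matrix V V ℝ} (hconn : StronglyConnected A)
    {d : V → ℝ} (hd : ∀ i, 0 < d i) : StronglyConnected (absorptionScaled A d) := by
  have h : (fun x y => 0 < absorptionScaled A d y x) = fun x y => 0 < A y x := by
    ext x y
    rw [absorptionScaled_apply A hd, mul_pos_iff_of_pos_right (inv_pos.2 (hd x))]
  intro i j
  rw [h]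
  exact hconn i j

/-- If `P` is the eigenprojection of `L D⁻¹` at `0` and `N` the corresponding group inverse, then
`D⁻¹ N` is the only absorption inverse of `L`. -/
theorem isAbsorptionInverse_iff {L N P M : Matrix V V ℝ} {d : V → ℝ} (hd : ∀ i, 0 < d i)
    (hLP : L * (Matrix.diagonal d)⁻¹ * P = 0) (hPL : P * (L * (Matrix.diagonal d)⁻¹) = 0)
    (hLM : L * (Matrix.diagonal d)⁻¹ * M = 1 - P)
    (hLN : L * (Matrix.diagonal d)⁻¹ * N = 1 - P) (hNL : N * (L * (Matrix.diagonal d)⁻¹) = 1 - P)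
    (hPN : P * N = 0) (hNP : N * P = 0) (X : Matrix V V ℝ) :
    IsAbsorptionInverse L d X ↔ X = (Matrix.diagonal d)⁻¹ * N := by
  have hu := isUnit_det_diagonal hd
  set D := Matrix.diagonal d with hD
  have hDi : D⁻¹ * D = 1 := Matrix.nonsing_inv_mul D hu
  have hDi' : D * D⁻¹ = 1 := Matrix.mul_nonsing_inv D hu
  have hL : L * D⁻¹ * D = L := by rw [Matrix.mul_assoc, hDi, Matrix.mul_one]
  constructor
  · rintro ⟨h1, h2⟩
    refine Matrix.ext_of_mulVec_single fun j => ?_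
    generalize (Pi.single j 1 : V → ℝ) = z
    -- Each `z` splits as `L D⁻¹ N z + P z`. On the first part `X` is prescribed because `D⁻¹ N z`
    -- lies in `N10`, with preimage `D⁻¹ M N z`; on the second it vanishes because `P z` lies in
    -- `R10`.
    have h3 := h1 ((D⁻¹ * N).mulVec z) ⟨(D⁻¹ * M * N).mulVec z, by
      rw [← hD, Matrix.mulVec_mulVec, Matrix.mulVec_mulVec, ← Matrix.mul_assoc, ← Matrix.mul_assoc,
        hLM, ← Matrix.mul_assoc, hDi', Matrix.sub_mul, hPN, sub_zero]⟩
    have h4 := h2 (P.mulVec z) ⟨(D⁻¹ * P).mulVec z, by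
      rw [Matrix.mulVec_mulVec, ← Matrix.mul_assoc, hLP, Matrix.zero_mulVec], by
      rw [← hD, Matrix.mulVec_mulVec, ← Matrix.mul_assoc, hDi', Matrix.one_mul]⟩
    rw [Matrix.mulVec_mulVec z L, ← Matrix.mul_assoc, hLN, Matrix.sub_mulVec, Matrix.one_mulVec,
      Matrix.mulVec_sub, h4, sub_zero] at h3
    exact h3
  · rintro rfl
    constructor
    · rintro y ⟨w, hw⟩
      have h1 : P.mulVec (D.mulVec y) = 0 := by
        rw [← hw, ← hL, Matrix.mulVec_mulVec, ← Matrix.mul_assoc, hPL, Matrix.zero_mul,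
          Matrix.zero_mulVec]
      calc (D⁻¹ * N).mulVec (L.mulVec y)
          = (D⁻¹ * (N * (L * D⁻¹)) * D).mulVec y := by
            rw [Matrix.mulVec_mulVec]
            simp only [Matrix.mul_assoc, hDi, Matrix.mul_one]
        _ = y := by
            rw [hNL, Matrix.mul_sub, Matrix.mul_one, Matrix.sub_mul, hDi, Matrix.sub_mulVec,
              Matrix.one_mulVec, ← Matrix.mulVec_mulVec, ← Matrix.mulVec_mulVec, h1,
              Matrix.mulVec_zero, sub_zero]
    · rintro _ ⟨x, hx, rfl⟩
      -- The vector `D x` is in the kernel of `L D⁻¹`, so it is fixed by `P`, and `N P = 0`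
      -- finishes.
      have h1 : D.mulVec x = P.mulVec (D.mulVec x) := by
        have h2 : (N * (L * D⁻¹)).mulVec (D.mulVec x) = 0 := by
          rw [Matrix.mulVec_mulVec, Matrix.mul_assoc, hL, ← Matrix.mulVec_mulVec, hx,
            Matrix.mulVec_zero]
        rwa [hNL, Matrix.sub_mulVec, Matrix.one_mulVec, sub_eq_zero] at h2
      rw [← hD, h1, Matrix.mulVec_mulVec, Matrix.mul_assoc, hNP, Matrix.mul_zero,
        Matrix.zero_mulVec]

/-- By the recursion, `Q` equals its `σ` times the identity up to a right multiple of the Laplacian,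
which kills `P`. -/
theorem Q_mul_of_laplacian_mul_eq_zero {A : Matrix V V ℝ} (hA : ∀ i j, 0 ≤ A i j)
    {P : Matrix V V ℝ} (hP : laplacian A * P = 0) (k : ℤ) : Q A k * P = sigma A k • P := by
  have h := Q_mul_laplacian hA (k - 1)
  rw [sub_add_cancel] at h
  have h' : Q A k = sigma A k • 1 - Q A (k - 1) * laplacian A := by rw [h, sub_sub_cancel]
  rw [h', Matrix.sub_mul, Matrix.mul_assoc, hP, Matrix.mul_zero, sub_zero, Matrix.smul_mul,
    Matrix.one_mul]

theorem mul_Q_of_mul_laplacian_eq_zero {A : Matrix V V ℝ} (hA : ∀ i j, 0 ≤ A i j)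
    {P : Matrix V V ℝ} (hP : P * laplacian A = 0) (k : ℤ) : P * Q A k = sigma A k • P := by
  have h := Q_mul_laplacian hA (k - 1)
  rw [sub_add_cancel, (commute_Q_laplacian hA (k - 1)).eq] at h
  have h' : Q A k = sigma A k • 1 - laplacian A * Q A (k - 1) := by rw [h, sub_sub_cancel]
  rw [h', Matrix.mul_sub, ← Matrix.mul_assoc, hP, Matrix.zero_mul, sub_zero, Matrix.mul_smul,
    Matrix.mul_one]

/-! ### The eigenprojection and the group inverse from the largest forests -/

section Nonempty

variable [Nonempty V] {A : Matrix V V ℝ}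

theorem sigma_card_sub_one_pos (hA : ∀ i j, 0 ≤ A i j) (hconn : StronglyConnected A) :
    0 < sigma A ((Fintype.card V : ℤ) - 1) := by
  have h : 0 < Fintype.card V := Fintype.card_pos
  have := sigma_pos hA hconn (Fintype.card V - 1) (by omega)
  rwa [Nat.cast_sub h, Nat.cast_one] at this

theorem J_card_sub_one_mul_laplacian (hA : ∀ i j, 0 ≤ A i j) :
    J A ((Fintype.card V : ℤ) - 1) * laplacian A = 0 := by
  have h0 := sigma_card_eq_zero hA
  have h := Q_mul_laplacian hA ((Fintype.card V : ℤ) - 1)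
  rw [sub_add_cancel, h0, Q_eq_zero_of_sigma_eq_zero hA h0, zero_smul, sub_zero] at h
  rw [J, Matrix.smul_mul, h, smul_zero]

theorem laplacian_mul_J_card_sub_one (hA : ∀ i j, 0 ≤ A i j) :
    laplacian A * J A ((Fintype.card V : ℤ) - 1) = 0 := by
  rw [← J_card_sub_one_mul_laplacian hA, J, Matrix.smul_mul, Matrix.mul_smul,
    (commute_Q_laplacian hA _).eq]

theorem Q_card_sub_two_mul_laplacian (hA : ∀ i j, 0 ≤ A i j) (hconn : StronglyConnected A) :
    ((sigma A ((Fintype.card V : ℤ) - 1))⁻¹ • Q A ((Fintype.card V : ℤ) - 2)) * laplacian A =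
      1 - J A ((Fintype.card V : ℤ) - 1) := by
  have h := Q_mul_laplacian hA ((Fintype.card V : ℤ) - 2)
  rw [show (Fintype.card V : ℤ) - 2 + 1 = Fintype.card V - 1 by ring] at h
  rw [Matrix.smul_mul, h, smul_sub, smul_smul,
    inv_mul_cancel₀ (sigma_card_sub_one_pos hA hconn).ne', one_smul, J]

theorem J_card_sub_one_apply_eq (hA : ∀ i j, 0 ≤ A i j) (hconn : StronglyConnected A)
    (i j l : V) :
    J A ((Fintype.card V : ℤ) - 1) i j = J A ((Fintype.card V : ℤ) - 1) i l :=
  row_eq_of_mul_laplacian_eq_zero hA hconn (J_card_sub_one_mul_laplacian hA) i j l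

/-- The matrix `1 - J` is a left multiple of the Laplacian, so it kills the kernel. -/
theorem eq_J_mulVec_of_laplacian_mulVec_eq_zero (hA : ∀ i j, 0 ≤ A i j)
    (hconn : StronglyConnected A) {x : V → ℝ} (hx : (laplacian A).mulVec x = 0) :
    x = (J A ((Fintype.card V : ℤ) - 1)).mulVec x := by
  have h := congrArg (fun M => M.mulVec x) (Q_card_sub_two_mul_laplacian hA hconn)
  simp only [← Matrix.mulVec_mulVec, hx, Matrix.mulVec_zero, Matrix.sub_mulVec,
    Matrix.one_mulVec] at h
  exact sub_eq_zero.1 h.symm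

theorem J_card_sub_one_mulVec_apply (hA : ∀ i j, 0 ≤ A i j) (hconn : StronglyConnected A)
    (x : V → ℝ) (i j : V) :
    (J A ((Fintype.card V : ℤ) - 1)).mulVec x i =
      J A ((Fintype.card V : ℤ) - 1) i j * ∑ l, x l := by
  rw [Matrix.mulVec, dotProduct, mul_sum]
  exact sum_congr rfl fun l _ => by rw [J_card_sub_one_apply_eq hA hconn i l j]

theorem existsUnique_isPositiveKernelBasis (hA : ∀ i j, 0 ≤ A i j)
    (hconn : StronglyConnected A) : ∃! u, IsPositiveKernelBasis (laplacian A) u := by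
  obtain ⟨j⟩ := ‹Nonempty V›
  have : Nonempty V := ⟨j⟩
  set P := J A ((Fintype.card V : ℤ) - 1) with hP
  have hsum : ∑ i, P i j = 1 := by
    simp only [hP, J, Matrix.smul_apply, smul_eq_mul]
    rw [← mul_sum, sum_Q_apply hA, inv_mul_cancel₀ (sigma_card_sub_one_pos hA hconn).ne']
  have hker : (laplacian A).mulVec (fun i => P i j) = 0 := by
    ext i
    exact congrFun (congrFun (laplacian_mul_J_card_sub_one hA) i) j
  -- Any column of `P` will do: all columns are equal, they lie in the kernel, and they sum to one.
  refine ⟨fun i => P i j, ⟨pos_of_laplacian_mulVec_eq_zero hA hconn hker (fun i => ?_) ?_, ?_,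
    hsum⟩, ?_⟩
  · exact mul_nonneg (inv_nonneg.2 (sigma_nonneg hA _)) (Q_nonneg hA _ i j)
  · intro h
    simp only [funext_iff, Pi.zero_apply] at h
    simp [h] at hsum
  · ext x
    rw [LinearMap.mem_ker, Matrix.toLin'_apply, Submodule.mem_span_singleton]
    constructor
    · intro hx
      refine ⟨∑ l, x l, ?_⟩
      conv_rhs => rw [eq_J_mulVec_of_laplacian_mulVec_eq_zero hA hconn hx]
      ext i
      rw [J_card_sub_one_mulVec_apply hA hconn x i j, Pi.smul_apply, smul_eq_mul, mul_comm]
    · rintro ⟨a, rfl⟩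
      rw [Matrix.mulVec_smul, hker, smul_zero]
  · rintro u ⟨-, hu, hu1⟩
    have hu0 : (laplacian A).mulVec u = 0 := by
      rw [← Matrix.toLin'_apply, ← LinearMap.mem_ker, hu]
      exact Submodule.mem_span_singleton_self u
    ext i
    rw [eq_J_mulVec_of_laplacian_mulVec_eq_zero hA hconn hu0,
      J_card_sub_one_mulVec_apply hA hconn u i j, hu1, mul_one]

/-- The absorption inverse in terms of forests of the absorption-scaled graph. -/
theorem isAbsorptionInverse_laplacian_iff (hA : ∀ i j, 0 ≤ A i j) (hconn : StronglyConnected A)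
    {d : V → ℝ} (hd : ∀ i, 0 < d i) (X : Matrix V V ℝ) :
    IsAbsorptionInverse (laplacian A) d X ↔
      X = (Matrix.diagonal d)⁻¹ *
        ((sigma (absorptionScaled A d) ((Fintype.card V : ℤ) - 1))⁻¹ •
            Q (absorptionScaled A d) ((Fintype.card V : ℤ) - 2) -
          (sigma (absorptionScaled A d) ((Fintype.card V : ℤ) - 2) /
            sigma (absorptionScaled A d) ((Fintype.card V : ℤ) - 1)) •
              J (absorptionScaled A d) ((Fintype.card V : ℤ) - 1)) := by
  have hL := laplacian_absorptionScaled A hd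
  have hB : ∀ i j, 0 ≤ absorptionScaled A d i j := absorptionScaled_nonneg hA hd
  have hBconn := stronglyConnected_absorptionScaled hconn hd
  generalize absorptionScaled A d = B at *
  have hs := (sigma_card_sub_one_pos hB hBconn).ne'
  have hPL := J_card_sub_one_mul_laplacian hB
  have hLP := laplacian_mul_J_card_sub_one hB
  have hML := Q_card_sub_two_mul_laplacian hB hBconn
  have hLM : laplacian B * ((sigma B ((Fintype.card V : ℤ) - 1))⁻¹ •
      Q B ((Fintype.card V : ℤ) - 2)) = 1 - J B ((Fintype.card V : ℤ) - 1) := by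
    rw [← hML, Matrix.smul_mul, Matrix.mul_smul, (commute_Q_laplacian hB _).eq]
  have hPP : J B ((Fintype.card V : ℤ) - 1) * J B ((Fintype.card V : ℤ) - 1) =
      J B ((Fintype.card V : ℤ) - 1) := by
    conv_lhs => enter [1]; rw [J]
    rw [Matrix.smul_mul, Q_mul_of_laplacian_mul_eq_zero hB hLP, smul_smul, inv_mul_cancel₀ hs,
      one_smul]
  have hMP := Q_mul_of_laplacian_mul_eq_zero hB hLP ((Fintype.card V : ℤ) - 2)
  have hPM := mul_Q_of_mul_laplacian_eq_zero hB hPL ((Fintype.card V : ℤ) - 2)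
  rw [hL] at hPL hLP hML hLM
  -- The matrix `M = Q_{n-2} / σ_{n-1}` already inverts modulo `P`, but `P M` and `M P` equal
  -- `(σ_{n-2} / σ_{n-1}) P`. The subtracted multiple of `P` removes exactly this and does not
  -- affect products with the Laplacian.
  refine isAbsorptionInverse_iff hd hLP hPL hLM ?_ ?_ ?_ ?_ X
  · rw [Matrix.mul_sub, hLM, Matrix.mul_smul, hLP, smul_zero, sub_zero]
  · rw [Matrix.sub_mul, hML, Matrix.smul_mul, hPL, smul_zero, sub_zero]
  · rw [Matrix.mul_sub, Matrix.mul_smul, Matrix.mul_smul, hPM, hPP, smul_smul, inv_mul_eq_div,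
      sub_self]
  · rw [Matrix.sub_mul, Matrix.smul_mul, Matrix.smul_mul, hMP, hPP, smul_smul, inv_mul_eq_div,
      sub_self]

/-- The vector `D u` is in the kernel of `L D⁻¹`, so `J` fixes it; constant rows turn `J (D u)` into
an entry of `J` times the sum of `D u`. -/
theorem J_absorptionScaled_apply (hA : ∀ i j, 0 ≤ A i j) (hconn : StronglyConnected A)
    {d : V → ℝ} (hd : ∀ i, 0 < d i) {u : V → ℝ} (hu : (laplacian A).mulVec u = 0) (i j : V) :
    J (absorptionScaled A d) ((Fintype.card V : ℤ) - 1) i j * ∑ l, d l * u l = d i * u i := by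
  have hB : ∀ i j, 0 ≤ absorptionScaled A d i j := absorptionScaled_nonneg hA hd
  have hBconn := stronglyConnected_absorptionScaled hconn hd
  have h : (laplacian (absorptionScaled A d)).mulVec ((Matrix.diagonal d).mulVec u) = 0 := by
    rw [laplacian_absorptionScaled A hd, Matrix.mulVec_mulVec, Matrix.mul_assoc,
      Matrix.nonsing_inv_mul _ (isUnit_det_diagonal hd), Matrix.mul_one, hu]
  have h1 := congrFun (eq_J_mulVec_of_laplacian_mulVec_eq_zero hB hBconn h) i
  rw [J_card_sub_one_mulVec_apply hB hBconn _ i j] at h1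
  simpa only [Matrix.mulVec_diagonal] using h1.symm

end Nonempty

end AbsorptionGraph

/-! ### The formula for the absorption inverse -/

open AbsorptionGraph in
theorem theorem6 {n : ℕ} (hn : 1 ≤ n) (A : Matrix (Fin n) (Fin n) ℝ)
    (hA : ∀ i j, 0 ≤ A i j) (hconn : AbsorptionGraph.StronglyConnected A)
    (d : Fin n → ℝ) (hd : ∀ i, 0 < d i) :
    (∃! X, AbsorptionGraph.IsAbsorptionInverse (AbsorptionGraph.laplacian A) d X) ∧
    (∃! u, AbsorptionGraph.IsPositiveKernelBasis (AbsorptionGraph.laplacian A) u) ∧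
    0 < AbsorptionGraph.sigma (AbsorptionGraph.absorptionScaled A d) ((n : ℤ) - 1) ∧
    (2 ≤ n → 0 < AbsorptionGraph.sigma (AbsorptionGraph.absorptionScaled A d) ((n : ℤ) - 2)) ∧
    ∀ (Ld : Matrix (Fin n) (Fin n) ℝ) (u : Fin n → ℝ),
      AbsorptionGraph.IsAbsorptionInverse (AbsorptionGraph.laplacian A) d Ld →
      AbsorptionGraph.IsPositiveKernelBasis (AbsorptionGraph.laplacian A) u →
      Ld = (AbsorptionGraph.sigma (AbsorptionGraph.absorptionScaled A d) ((n : ℤ) - 2) /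
            AbsorptionGraph.sigma (AbsorptionGraph.absorptionScaled A d) ((n : ℤ) - 1)) •
          ((Matrix.diagonal d)⁻¹ *
            (AbsorptionGraph.J (AbsorptionGraph.absorptionScaled A d) ((n : ℤ) - 2) -
              AbsorptionGraph.J (AbsorptionGraph.absorptionScaled A d) ((n : ℤ) - 1))) ∧
      ∀ i j : Fin n,
        Ld i j =
          AbsorptionGraph.setWeight (AbsorptionGraph.absorptionScaled A d)
              (AbsorptionGraph.inForestsTo (AbsorptionGraph.absorptionScaled A d)
                ((n : ℤ) - 2) j i) /
            (d i * AbsorptionGraph.sigma (AbsorptionGraph.absorptionScaled A d) ((n : ℤ) - 1)) -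
          AbsorptionGraph.sigma (AbsorptionGraph.absorptionScaled A d) ((n : ℤ) - 2) * u i /
            (AbsorptionGraph.sigma (AbsorptionGraph.absorptionScaled A d) ((n : ℤ) - 1) *
              ∑ l, d l * u l) := by
  have : Nonempty (Fin n) := ⟨⟨0, hn⟩⟩
  have hB : ∀ i j, 0 ≤ absorptionScaled A d i j := absorptionScaled_nonneg hA hd
  have hBconn := stronglyConnected_absorptionScaled hconn hd
  have hX := isAbsorptionInverse_laplacian_iff hA hconn hd
  have hpos := sigma_card_sub_one_pos hB hBconn
  have hJ := fun u hu => J_absorptionScaled_apply (u := u) hA hconn hd hu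
  simp only [Fintype.card_fin] at hX hpos hJ
  refine ⟨⟨_, (hX _).2 rfl, fun Y hY => (hX Y).1 hY⟩,
    existsUnique_isPositiveKernelBasis hA hconn, hpos, fun h2 => ?_, fun Ld u hLd hu => ?_⟩
  · have := sigma_pos hB hBconn (n - 2) (by simp; omega)
    rwa [Nat.cast_sub h2, Nat.cast_ofNat] at this
  · rw [(hX Ld).1 hLd]
    constructor
    · rw [← Matrix.mul_smul, smul_sub]
      congr 2
      -- For `n = 1` the weight `σ_{n-2}` is zero. Then `Q_{n-2}` vanishes as well, and the quotient
      -- `σ_{n-2} / σ_{n-1}` is zero, so both sides agree.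
      by_cases h0 : sigma (absorptionScaled A d) ((n : ℤ) - 2) = 0
      · rw [Q_eq_zero_of_sigma_eq_zero hB h0, h0, zero_div, smul_zero, zero_smul]
      · rw [J, smul_smul, div_mul_eq_mul_div, mul_inv_cancel₀ h0, one_div]
    · intro i j
      have hu0 : (laplacian A).mulVec u = 0 := by
        rw [← Matrix.toLin'_apply, ← LinearMap.mem_ker, hu.2.1]
        exact Submodule.mem_span_singleton_self u
      have hdu : 0 < ∑ l, d l * u l :=
        Finset.sum_pos (fun l _ => mul_pos (hd l) (hu.1 l)) Finset.univ_nonempty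
      have hP : J (absorptionScaled A d) ((n : ℤ) - 1) i j = d i * u i / ∑ l, d l * u l :=
        (eq_div_iff hdu.ne').2 (hJ u hu0 i j)
      rw [diagonal_inv hd, Matrix.diagonal_mul, Matrix.sub_apply, Matrix.smul_apply,
        Matrix.smul_apply, hP, Q, Matrix.of_apply, smul_eq_mul, smul_eq_mul]
      have := (hd i).ne'
      have := hpos.ne'
      have := hdu.ne'
      field_simp
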